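/- Let $T$ be a complete first-order theory with infinite models, in a language $L$, and write $|T|=|L|+\aleph_0$. Suppose that $T$ is NIP: for no $L$-formula $\varphi(x,y)$ ($x,y$ finite tuples of variables) are there, in a model of $T$, tuples $(a_t)_{t\in\omega}$ and $(b_s)_{s\subseteq\omega}$ such that $\varphi(a_t,b_s)$ holds if and only if $t\in s$. Then for every cardinal $\kappa\geq|T|$ there is a model $M$ of $T$ with $|M|=\kappa$ such that $$|S(A)|\leq|A|^{|T|}\quad\text{for every } A\subseteq M \text{ with } |A|\geq 2,$$ where $S(A)=\bigcup_{n<\omega}S_n(A)$ is the set of complete finitary types over $A$. Moreover, $M$ can be chosen to be the Skolem hull of an indiscernible sequence: there are a Skolemization $T'\supseteq T$ in a language $L'\supseteq L$ with $|L'|\leq|T|$ (every model of $T$ expands to a model of $T'$, and for every $L'$-formula $\varphi(x,y)$, with $x$ a finite tuple and $y$ a single variable, there is an $L'$-term $t(x)$ with $T'\models\forall x\,(\exists y\,\varphi(x,y)\to\varphi(x,t(x)))$), an expansion of $M$ to a model of $T'$, and an $L'$-indiscernible sequence $(a_\alpha)_{\alpha<\kappa}$ of distinct elements of $M$ that generates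 $M$ under the functions of $L'$. -/

import Mathlib

universe u v w

open FirstOrder

namespace NIPFewTypes

open FirstOrder.Language Cardinal

variable {L : FirstOrder.Language.{u, v}}

/-- `|T|`: the cardinality of the language of `T` plus `ℵ₀` (the number of `L`-formulas). -/
noncomputable def theoryCard (_T : L.Theory) : Cardinal.{max u v} :=
  max ℵ₀ L.card

/-- `φ(x, y)` is NIP modulo `T`: in no model of `T` are there tuples `(a_t)` for `t ∈ ω` and
`(b_s)` for `s ⊆ ω` with `φ(a_t, b_s) ↔ t ∈ s`. A model containing such a pattern has an
elementary substructure of size at most `|T| + 2 ^ ℵ₀` containing it, so it is enough to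
look at models in the universe `max u v`. -/
def FormulaNIP (T : L.Theory) {m n : ℕ} (φ : L.Formula (Fin m ⊕ Fin n)) : Prop :=
  ∀ N : Theory.ModelType.{u, v, max u v} T,
    ¬ ∃ (a : ℕ → Fin m → N) (b : Set ℕ → Fin n → N),
      ∀ (t : ℕ) (s : Set ℕ), φ.Realize (Sum.elim (a t) (b s)) ↔ t ∈ s

/-- `T` is NIP: every partitioned formula is NIP modulo `T`. -/
def TheoryNIP (T : L.Theory) : Prop :=
  ∀ (m n : ℕ) (φ : L.Formula (Fin m ⊕ Fin n)), FormulaNIP T φ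

/-- `S_n(A)`: complete `n`-types over a parameter set `A ⊆ M`, that is, complete `n`-types of the
`L(A)`-theory of `M`. -/
abbrev TypesOver (L : FirstOrder.Language.{u, v}) {M : Type w} [L.Structure M] [Nonempty M] (A : Set M)
    (n : ℕ) :=
  Theory.CompleteType (L[[A]].completeTheory M) (Fin n)

/-- `S(A)`: complete finitary types over `A`. -/
abbrev AllTypesOver (L : FirstOrder.Language.{u, v}) {M : Type w} [L.Structure M] [Nonempty M] (A : Set M) :=
  Σ n : ℕ, TypesOver L A n

/-- The sequence `(a_i)_{i ∈ J}` of elements of `M` is indiscernible (over `∅`, for `L`-formulas). -/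
def Indiscernible (L : FirstOrder.Language.{u, v}) {M : Type*} [L.Structure M] {J : Type*} [LinearOrder J]
    (a : J → M) : Prop :=
  ∀ (n : ℕ) (φ : L.Formula (Fin n)) (i j : Fin n → J), StrictMono i → StrictMono j →
    (φ.Realize (a ∘ i) ↔ φ.Realize (a ∘ j))

/-- `T'` (in the language `L'`, which extends `L` along `ι`) is a Skolemization of `T`. Models are
taken in `Type w`; it is used with a `w` large enough for this to be no restriction. -/
structure IsSkolemization {L' : FirstOrder.Language.{max u v, v}} (ι : L →ᴸ L') (T : L.Theory)
    (T' : L'.Theory) : Prop where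
  injective : ι.Injective
  card_le : L'.card ≤ theoryCard T
  extends_theory : ι.onTheory T ⊆ T'
  /-- Every model of `T` expands to a model of `T'`. -/
  expands : ∀ N : Theory.ModelType.{u, v, w} T,
    ∃ _ : L'.Structure N, ι.IsExpansionOn N ∧ (N : Type w) ⊨ T'
  /-- For every `φ(x, y)` there is a term `t(x)` with `T' ⊨ ∀ x (∃ y φ(x, y) → φ(x, t(x)))`. -/
  skolem : ∀ (n : ℕ) (φ : L'.Formula (Fin (n + 1))), ∃ t : L'.Term (Fin n),
    ∀ (N : Theory.ModelType.{max u v, v, w} T') (x : Fin n → N) (y : N),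
      φ.Realize (Fin.snoc x y : Fin (n + 1) → N) →
        φ.Realize (Fin.snoc x (t.realize x) : Fin (n + 1) → N)

/-- `M` is the Skolem hull of an indiscernible sequence of `κ` distinct elements: for some
Skolemization `T'` of `T`, `M` expands to a model of `T'` that is generated, under the functions of
the language of `T'`, by an `L'`-indiscernible sequence indexed by the ordinal `κ`. -/
def IsSkolemHullOfIndiscernible (T : L.Theory) (M : Theory.ModelType.{u, v, w} T)
    (κ : Cardinal.{w}) : Prop :=
  ∃ (L' : FirstOrder.Language.{max u v, v}) (ι : L →ᴸ L') (T' : L'.Theory),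
    IsSkolemization.{u, v, w} ι T T' ∧
    ∃ _ : L'.Structure M, ι.IsExpansionOn M ∧ (M : Type w) ⊨ T' ∧
      ∃ a : κ.ord.ToType → M, Function.Injective a ∧ Indiscernible L' a ∧
        Substructure.closure L' (Set.range a) = ⊤

end NIPFewTypes

/-! The model is the Skolem hull of an indiscernible sequence `(a_i)` along the well-order `κ`. A
set `A` in the hull is already contained in the hull of a set `I` of at most `|A| + ℵ₀` indices.
Every formula over `A` is an instance `φ(t(a_i), y)` with `i` an increasing tuple from `I` and `t` a
tuple of terms. Extend a type over `A` to an ultrafilter on tuples of the model, and let the trace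
of `(φ, t)` be the set of increasing `i` whose instance belongs to it. The traces determine the
type, and there are at most `|T|` pairs `(φ, t)`. So it suffices that each trace is coded by one of
`|A| + ℵ₀` objects: then there are at most `(|A| + ℵ₀)^|T|` types, which is at most `|A|^|T|`
because `|A| ≥ 2`.

The heart is that NIP makes a trace depend only on the position of `i` relative to a finite set `D ⊆
I` (`no_orderPattern_traceOf`, `exists_finset_of_no_orderPattern`). Consider the moves that raise
one coordinate, keep the tuple increasing and change membership in the trace; each sweeps out a
closed interval. If a finite `D` meets all these intervals, tuples in the same position relative to
`D` are joined by raisings that never change membership. Otherwise, by well-ordering, arbitrarily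
many moves have disjoint intervals (`exists_piercing`). A `k`-tuple meets at most `k` of these, so a
large subfamily is independent: no tuple enters the interval of another move. Choosing either end of
each of these moves then leaves the overall order type unchanged. The ultrafilter makes every
pattern of truth values consistent for the corresponding choice of ends, and indiscernibility
transfers all patterns to one fixed choice. Thus `φ` shatters arbitrarily large finite sets, against
NIP. -/

namespace NIPFewTypes

universe u' v' w' x

open FirstOrder.Language Cardinal

/-! ### Finite combinatorics: independent sets and piercing of intervals -/

/-- In a digraph on a finite set whose out-degrees are at most `k`, there are large independent
sets. -/
theorem exists_independent_of_outdegree_le {V : Type*} [DecidableEq V] (R : V → V → Prop)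
    [DecidableRel R] (k N : ℕ) (s : Finset V) (hdeg : ∀ i ∈ s, (s.filter (R i)).card ≤ k)
    (hs : N * (2 * k + 1) ≤ s.card) :
    ∃ t ⊆ s, t.card = N ∧ ∀ i ∈ t, ∀ j ∈ t, i ≠ j → ¬ R i j := by
  induction N generalizing s with
  | zero => exact ⟨∅, by simp⟩
  | succ N ih =>
    have hne : s.Nonempty := by
      rw [← Finset.card_pos]
      nlinarith
    -- Counting arcs from both ends, the average in-degree equals the average out-degree, so some
    -- vertex has in-degree at most `k`.
    obtain ⟨j, hj, hjk⟩ : ∃ j ∈ s, (s.filter (R · j)).card ≤ k := by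
      apply Finset.exists_le_of_sum_le hne
      have := Finset.sum_card_bipartiteAbove_eq_sum_card_bipartiteBelow (s := s) (t := s) R
      simp only [Finset.bipartiteAbove, Finset.bipartiteBelow] at this
      rw [← this]
      exact Finset.sum_le_sum hdeg
    -- Choosing `j` costs `j` itself and at most `k` neighbours in each direction, whence the factor
    -- `2 * k + 1`.
    let s' := s.filter (fun i => i ≠ j ∧ ¬ R i j ∧ ¬ R j i)
    have hcover : s ⊆ s' ∪ ({j} ∪ (s.filter (R · j) ∪ s.filter (R j))) := by
      intro i hi
      simp only [s', Finset.mem_union, Finset.mem_filter, Finset.mem_singleton]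
      tauto
    have hcard : s.card ≤ s'.card + (1 + (k + k)) := by
      refine (Finset.card_le_card hcover).trans ((Finset.card_union_le _ _).trans ?_)
      gcongr
      refine (Finset.card_union_le _ _).trans ?_
      gcongr
      · simp
      · exact (Finset.card_union_le _ _).trans (add_le_add hjk (hdeg j hj))
    have hss : s' ⊆ s := Finset.filter_subset _ _
    obtain ⟨t, hts, htN, ht⟩ := ih s'
      (fun i hi => (Finset.card_le_card (Finset.filter_subset_filter _ hss)).trans
        (hdeg i (hss hi)))
      (by linarith)
    have hjt : j ∉ t := fun h => by simpa [s'] using hts h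
    refine ⟨insert j t, Finset.insert_subset hj (hts.trans hss), by
      rw [Finset.card_insert_of_notMem hjt, htN], ?_⟩
    have aux : ∀ i ∈ t, ¬ R i j ∧ ¬ R j i := fun i hi => (Finset.mem_filter.1 (hts hi)).2.2
    intro a ha b hb hab
    rcases Finset.mem_insert.1 ha with ha' | ha'
    · rcases Finset.mem_insert.1 hb with hb' | hb'
      · exact absurd (ha'.trans hb'.symm) hab
      · exact ha' ▸ (aux b hb').2
    · rcases Finset.mem_insert.1 hb with hb' | hb'
      · exact hb' ▸ (aux a ha').1
      · exact ht a ha' b hb' hab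

/-- A family of closed intervals of a well-order either contains `N` pairwise disjoint members
or is pierced by a finite set. -/
theorem exists_piercing {I : Type*} [LinearOrder I] [WellFoundedLT I] {β : Type*}
    (lo hi : β → I) (N : ℕ) (B : Set β)
    (hB : ¬ ∃ c : Fin N → β, (∀ i, c i ∈ B) ∧ ∀ i j, i < j → hi (c i) < lo (c j)) :
    ∃ D : Finset I, ∀ x ∈ B, ∃ d ∈ D, lo x ≤ d ∧ d ≤ hi x := by
  induction N generalizing B with
  | zero => exact absurd ⟨fun i => i.elim0, fun i => i.elim0, fun i => i.elim0⟩ hB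
  | succ N ih =>
    rcases B.eq_empty_or_nonempty with rfl | hne
    · exact ⟨∅, by simp⟩
    let x₀ := Function.argminOn hi B hne
    have hx₀ : x₀ ∈ B := Function.argminOn_mem hi B hne
    have hmin : ∀ x ∈ B, hi x₀ ≤ hi x := fun x hx => Function.argminOn_le hi B hx
    -- Disjoint intervals to the right of the least right endpoint `hi x₀` could be prolonged by
    -- `x₀` in front. All other intervals contain `hi x₀`.
    obtain ⟨D, hD⟩ := ih {x ∈ B | hi x₀ < lo x} (by
      rintro ⟨c, hc, hlt⟩
      refine hB ⟨Fin.cons x₀ c, ?_, ?_⟩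
      · intro i
        refine Fin.cases ?_ (fun i => ?_) i
        · simpa using hx₀
        · simpa using (hc i).1
      · intro i j
        refine Fin.cases ?_ (fun i => ?_) i
        · refine Fin.cases ?_ (fun j => ?_) j
          · simp
          · intro _
            simpa using (hc j).2
        · refine Fin.cases ?_ (fun j => ?_) j
          · simp
          · intro h
            simpa using hlt i j (by simpa using h))
    classical
    refine ⟨insert (hi x₀) D, fun x hx => ?_⟩
    by_cases h : hi x₀ < lo x
    · obtain ⟨d, hd, h'⟩ := hD x ⟨hx, h⟩
      exact ⟨d, Finset.mem_insert_of_mem hd, h'⟩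
    · exact ⟨hi x₀, Finset.mem_insert_self _ _, not_lt.1 h, hmin x hx⟩

/-! ### Order patterns and dependence on a finite set of indices -/

/-- The choices `u i true`, `u i false` of `k`-tuples witness that `f` shatters a set of size `N`
in an order-homogeneous way: `f` separates the two tuples for each `i`, while the order type of a
choice of one tuple for each `i` does not depend on the choice. -/
def OrderPattern {I : Type*} [LinearOrder I] {k : ℕ} (f : (Fin k → I) → Prop) (N : ℕ)
    (u : Fin N → Bool → Fin k → I) : Prop :=
  (∀ i, f (u i true) ∧ ¬ f (u i false)) ∧
    ∀ (W W' : Fin N → Bool) (i j : Fin N) (l l' : Fin k),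
      u i (W i) l < u j (W j) l' ↔ u i (W' i) l < u j (W' j) l'

section Convex

variable {I : Type*} [LinearOrder I] {k : ℕ} {f : (Fin k → I) → Prop}

/-- A strictly increasing tuple, a position, and a new value for that position, such that moving
the tuple at that position does not disturb the order but changes the value of `f`. -/
structure Move (f : (Fin k → I) → Prop) where
  tuple : Fin k → I
  pos : Fin k
  target : I
  strictMono : StrictMono tuple
  lt_target : tuple pos < target
  target_lt : ∀ l, pos < l → target < tuple l
  change : ¬ (f tuple ↔ f (Function.update tuple pos target))

namespace Move

theorem strictMono_update (x : Move f) : StrictMono (Function.update x.tuple x.pos x.target) := by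
  intro l l' h
  by_cases h1 : l = x.pos
  · subst h1
    rw [Function.update_self, Function.update_of_ne h.ne']
    exact x.target_lt _ h
  · rw [Function.update_of_ne h1]
    by_cases h2 : l' = x.pos
    · subst h2
      rw [Function.update_self]
      exact (x.strictMono h).trans x.lt_target
    · rw [Function.update_of_ne h2]
      exact x.strictMono h

/-- The two tuples of a move, the one satisfying `f` first. -/
noncomputable def side (x : Move f) (b : Bool) : Fin k → I :=
  open Classical in
  if (f x.tuple ↔ b = true) then x.tuple else Function.update x.tuple x.pos x.target

theorem side_true (x : Move f) : f (x.side true) := by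
  have := x.change
  unfold side
  split_ifs with h <;> simp_all

theorem side_false (x : Move f) : ¬ f (x.side false) := by
  have := x.change
  unfold side
  split_ifs with h <;> simp_all

theorem side_strictMono (x : Move f) (b : Bool) : StrictMono (x.side b) := by
  unfold side
  split_ifs
  exacts [x.strictMono, x.strictMono_update]

theorem side_of_ne (x : Move f) (b : Bool) {l : Fin k} (h : l ≠ x.pos) :
    x.side b l = x.tuple l := by
  unfold side
  split_ifs
  · rfl
  · rw [Function.update_of_ne h]

theorem side_pos_mem (x : Move f) (b : Bool) :
    x.tuple x.pos ≤ x.side b x.pos ∧ x.side b x.pos ≤ x.target := by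
  unfold side
  split_ifs
  · exact ⟨le_rfl, x.lt_target.le⟩
  · rw [Function.update_self]
    exact ⟨x.lt_target.le, le_rfl⟩

end Move

/-- Moves with pairwise disjoint intervals, none of whose tuples meets the interval of another
move, give an order pattern. -/
theorem orderPattern_of_independent {N : ℕ} (c : Fin N → Move f)
    (hdisj : ∀ i j, i ≠ j → (c i).target < (c j).tuple (c j).pos ∨
      (c j).target < (c i).tuple (c i).pos)
    (hind : ∀ i j, i ≠ j → ∀ l, ¬ ((c j).tuple (c j).pos ≤ (c i).tuple l ∧
      (c i).tuple l ≤ (c j).target)) :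
    OrderPattern f N (fun i b => (c i).side b) := by
  refine ⟨fun i => ⟨(c i).side_true, (c i).side_false⟩, ?_⟩
  suffices H : ∀ (W W' : Fin N → Bool) (i j : Fin N) (l l' : Fin k),
      (c i).side (W i) l < (c j).side (W j) l' → (c i).side (W' i) l < (c j).side (W' j) l' from
    fun W W' i j l l' => ⟨H W W' i j l l', H W' W i j l l'⟩
  intro W W' i j l l' h
  by_cases hij : i = j
  · subst hij
    exact (c i).side_strictMono _ (((c i).side_strictMono _).lt_iff_lt.1 h)
  have a1 := (c i).side_pos_mem (W i)
  have a2 := (c i).side_pos_mem (W' i)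
  have b1 := (c j).side_pos_mem (W j)
  have b2 := (c j).side_pos_mem (W' j)
  by_cases hl : l = (c i).pos
  · subst hl
    by_cases hl' : l' = (c j).pos
    · subst hl'
      rcases hdisj i j hij with h' | h'
      · exact a2.2.trans_lt (h'.trans_le b2.1)
      · exact absurd (h.trans_le (b1.2.trans h'.le)) (not_lt.2 a1.1)
    · rw [(c j).side_of_ne _ hl'] at h ⊢
      have := hind j i (Ne.symm hij) l'
      by_contra hcon
      exact this ⟨a1.1.trans h.le, (not_lt.1 hcon).trans a2.2⟩
  · rw [(c i).side_of_ne _ hl] at h ⊢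
    by_cases hl' : l' = (c j).pos
    · subst hl'
      have := hind i j hij l
      by_contra hcon
      exact this ⟨b2.1.trans (not_lt.1 hcon), h.le.trans b1.2⟩
    · rwa [(c j).side_of_ne _ hl'] at h ⊢

/-- Many moves with disjoint intervals contain many independent ones. -/
theorem exists_orderPattern_of_disjoint {N : ℕ} (c : Fin (N * (2 * k + 1)) → Move f)
    (hc : ∀ i j, i < j → (c i).target < (c j).tuple (c j).pos) :
    ∃ u, OrderPattern f N u := by
  classical
  have hdisj : ∀ i j, i ≠ j → (c i).target < (c j).tuple (c j).pos ∨
      (c j).target < (c i).tuple (c i).pos := by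
    intro i j hij
    rcases lt_or_gt_of_ne hij with h | h
    exacts [Or.inl (hc _ _ h), Or.inr (hc _ _ h)]
  let R : Fin (N * (2 * k + 1)) → Fin (N * (2 * k + 1)) → Prop := fun i j =>
    ∃ l, (c j).tuple (c j).pos ≤ (c i).tuple l ∧ (c i).tuple l ≤ (c j).target
  obtain ⟨t, -, htN, ht⟩ := exists_independent_of_outdegree_le R k N Finset.univ (by
    intro i _
    have : ∀ j : (Finset.univ.filter (R i)), ∃ l, (c j).tuple (c j).pos ≤ (c i).tuple l ∧
        (c i).tuple l ≤ (c j).target := fun j => (Finset.mem_filter.1 j.2).2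
    choose g hg using this
    -- One coordinate cannot lie in two disjoint intervals, so the `k` coordinates of a tuple bound
    -- its out-degree by `k`.
    have hinj : Function.Injective g := by
      intro j j' hjj
      by_contra hne
      have h1 := hg j
      have h2 := hg j'
      rw [hjj] at h1
      rcases hdisj j j' (fun h => hne (Subtype.ext h)) with h | h
      · exact absurd (h1.2.trans_lt h) (not_lt.2 h2.1)
      · exact absurd (h2.2.trans_lt h) (not_lt.2 h1.1)
    have hle := Fintype.card_le_of_injective g hinj
    rwa [Fintype.card_coe, Fintype.card_fin] at hle) (by simp)
  let e := t.orderEmbOfFin htN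
  refine ⟨_, orderPattern_of_independent (fun i => c (e i))
    (fun i j hij => hdisj _ _ (fun h => hij (e.injective h))) ?_⟩
  intro i j hij l hl
  exact ht (e i) (t.orderEmbOfFin_mem htN i) (e j) (t.orderEmbOfFin_mem htN j)
    (fun h => hij (e.injective h)) ⟨l, hl⟩

/-- If no move has its interval disjoint from `D`, then `f` is invariant under raising strictly
increasing tuples without changing their position relative to `D`. -/
theorem iff_of_le_of_cmp_eq {D : Finset I}
    (hD : ∀ x : Move f, ∃ d ∈ D, x.tuple x.pos ≤ d ∧ d ≤ x.target) {u u' : Fin k → I}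
    (hu : StrictMono u) (hu' : StrictMono u') (hle : u ≤ u')
    (hcmp : ∀ l, ∀ d ∈ D, cmp (u l) d = cmp (u' l) d) : f u ↔ f u' := by
  -- Coordinates are raised from the last to the first: when coordinate `m` moves, those above it
  -- have already moved out of its way, so each hybrid tuple stays increasing.
  let g : ℕ → Fin k → I := fun m l => if (l : ℕ) < m then u l else u' l
  have hg0 : g 0 = u' := by funext l; simp [g]
  have hgk : g k = u := by funext l; simp [g]
  have hmono : ∀ m, StrictMono (g m) := by
    intro m l l' h
    have h' : (l : ℕ) < l' := h
    simp only [g]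
    split_ifs with h1 h2 h2
    · exact hu h
    · exact (hu h).trans_le (hle l')
    · omega
    · exact hu' h
  have hstep : ∀ m, m < k → (f (g (m + 1)) ↔ f (g m)) := by
    intro m hm
    have hupd : g m = Function.update (g (m + 1)) ⟨m, hm⟩ (u' ⟨m, hm⟩) := by
      funext l
      by_cases hl : l = ⟨m, hm⟩
      · subst hl; simp [g]
      · rw [Function.update_of_ne hl]
        have : (l : ℕ) ≠ m := fun h => hl (Fin.ext h)
        simp only [g]
        congr 1
        simp only [eq_iff_iff]
        omega
    have hval : g (m + 1) ⟨m, hm⟩ = u ⟨m, hm⟩ := by simp [g]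
    rcases (hle ⟨m, hm⟩).eq_or_lt with heq | hlt
    · rw [hupd, ← heq, ← hval, Function.update_eq_self]
    by_contra hcon
    obtain ⟨d, hd, h1, h2⟩ := hD
      { tuple := g (m + 1)
        pos := ⟨m, hm⟩
        target := u' ⟨m, hm⟩
        strictMono := hmono _
        lt_target := by rwa [hval]
        target_lt := by
          intro l hl
          have hl' : ¬ ((l : ℕ) < m + 1) := by
            have : m < (l : ℕ) := hl
            omega
          simp only [g, if_neg hl']
          exact hu' hl
        change := by rwa [← hupd] }
    replace h1 : u ⟨m, hm⟩ ≤ d := hval ▸ h1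
    have h := hcmp ⟨m, hm⟩ d hd
    rcases h1.eq_or_lt with h3 | h3
    · rw [h3, cmp_self_eq_eq, eq_comm, cmp_eq_eq_iff] at h
      exact absurd (h.trans h3.symm) hlt.ne'
    · rw [(cmp_eq_lt_iff _ _).2 h3, eq_comm, cmp_eq_lt_iff] at h
      exact absurd h (not_lt.2 h2)
  have hall : ∀ m, m ≤ k → (f (g m) ↔ f u') := by
    intro m
    induction m with
    | zero => intro _; rw [hg0]
    | succ m ih => intro hm; rw [hstep m hm, ih (by omega)]
  rw [← hall k le_rfl, hgk]

/-- A property of increasing tuples of a well-order that admits no large order pattern is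
determined by the position of the tuple relative to some finite set. -/
theorem exists_finset_of_no_orderPattern [WellFoundedLT I] {N : ℕ}
    (hN : ¬ ∃ u, OrderPattern f N u) :
    ∃ D : Finset I, ∀ u u' : Fin k → I, StrictMono u → StrictMono u' →
      (∀ l, ∀ d ∈ D, cmp (u l) d = cmp (u' l) d) → (f u ↔ f u') := by
  obtain ⟨D, hD⟩ := exists_piercing (fun x : Move f => x.tuple x.pos) (fun x => x.target)
    (N * (2 * k + 1)) Set.univ (by
      rintro ⟨c, -, hc⟩
      exact hN (exists_orderPattern_of_disjoint c hc))
  refine ⟨D, fun u u' hu hu' hcmp => ?_⟩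
  -- Two tuples in the same position relative to `D` need not be comparable, but their pointwise
  -- maximum lies above both and shares that position.
  have key : ∀ {v v' : Fin k → I}, StrictMono v → StrictMono v' →
      (∀ l, ∀ d ∈ D, cmp (v l) d = cmp (v' l) d) → (f v ↔ f (v ⊔ v')) := by
    intro v v' hv hv' h
    refine iff_of_le_of_cmp_eq (fun x => hD x trivial) hv
      (fun _ _ hlt => max_lt_max (hv hlt) (hv' hlt)) le_sup_left ?_
    intro l d hd
    rcases le_total (v l) (v' l) with h' | h'
    · rw [Pi.sup_apply, sup_eq_right.2 h', h l d hd]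
    · rw [Pi.sup_apply, sup_eq_left.2 h']
  rw [key hu hu' hcmp, key hu' hu (fun l d hd => (hcmp l d hd).symm), sup_comm]

end Convex

/-! ### Compactness, indiscernibility and finitary NIP -/

/-- Compactness: a family of formulas that is finitely realized in `N` is realized in some model of
the theory of `N`. -/
theorem exists_realize_of_finitely_realized {L : FirstOrder.Language.{u, v}} (N : Type w)
    [L.Structure N] [Nonempty N] {α : Type w'} {β : Type*} [Nonempty β] (γ : β → L.Formula α)
    (h : ∀ G : Finset β, ∃ v : α → N, ∀ i ∈ G, (γ i).Realize v) :
    ∃ (K : Theory.ModelType.{u, v, max u v w'} (L.completeTheory N)) (v : α → K),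
      ∀ i, (γ i).Realize v := by
  -- The complete theory is put into every piece, so that the union over the nonempty `β` contains
  -- it.
  let S : β → L[[α]].Theory := fun i =>
    (L.lhomWithConstants α).onTheory (L.completeTheory N) ∪ {Formula.equivSentence (γ i)}
  have hS : Theory.IsSatisfiable (⋃ i, S i) := by
    rw [Theory.isSatisfiable_iUnion_iff_isSatisfiable_iUnion_finset]
    intro G
    obtain ⟨v, hv⟩ := h G
    let _ : (constantsOn α).Structure N := constantsOn.structure v
    have : N ⊨ ⋃ i ∈ G, S i := by
      rw [Theory.model_iff]
      intro φ hφ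
      obtain ⟨i, hi, hφ⟩ := Set.mem_iUnion₂.1 hφ
      rcases hφ with hφ | hφ
      · have : N ⊨ (L.lhomWithConstants α).onTheory (L.completeTheory N) :=
          (LHom.onTheory_model _ _).2 inferInstance
        exact this.realize_of_mem φ hφ
      · rw [Set.mem_singleton_iff.1 hφ, Formula.realize_equivSentence]
        exact hv i hi
    exact Theory.Model.isSatisfiable N
  obtain ⟨K⟩ := hS
  have hmem : ∀ i, S i ⊆ ⋃ i, S i := fun i => Set.subset_iUnion S i
  let _ : L.Structure K := (L.lhomWithConstants α).reduct K
  have : (L.lhomWithConstants α).IsExpansionOn K := LHom.isExpansionOn_reduct _ _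
  have : K ⊨ L.completeTheory N := by
    rw [← (L.lhomWithConstants α).onTheory_model]
    obtain ⟨i⟩ := ‹Nonempty β›
    exact K.is_model.mono (Set.subset_union_left.trans (hmem i))
  refine ⟨Theory.ModelType.of _ K, fun a => ((L.con a : L[[α]].Constants) : K), fun i => ?_⟩
  exact (Formula.realize_equivSentence K (γ i)).1
    (K.is_model.realize_of_mem _ (hmem i (Or.inr rfl)))

/-- Formulas cannot distinguish finite families of members of an indiscernible sequence whose
indices have the same order type. -/
theorem Indiscernible.realize_iff {L : FirstOrder.Language.{u, v}} {M : Type*} [L.Structure M]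
    {J : Type*} [LinearOrder J] {a : J → M} (ha : Indiscernible L a) {Q : Type*} [Finite Q]
    (θ : L.Formula Q) {g g' : Q → J} (hg : ∀ q q', g q < g q' ↔ g' q < g' q') :
    θ.Realize (a ∘ g) ↔ θ.Realize (a ∘ g') := by
  classical
  have := Fintype.ofFinite Q
  let s : Finset J := Finset.univ.image g
  let e : Fin s.card ≃o s := s.orderIsoOfFin rfl
  let h : Q → Fin s.card := fun q => e.symm ⟨g q, Finset.mem_image_of_mem g (Finset.mem_univ q)⟩
  have hh : ∀ q, (e (h q) : J) = g q := fun q => by simp [h]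
  have hsurj : ∀ x, ∃ q, g q = e x := fun x => by
    obtain ⟨q, -, hq⟩ := Finset.mem_image.1 (e x).2
    exact ⟨q, hq⟩
  choose r hr using hsurj
  have h1 : StrictMono (fun x => (e x : J)) := fun x y hxy => e.strictMono hxy
  have h2 : StrictMono (g' ∘ r) := fun x y hxy => by
    refine (hg _ _).1 ?_
    rw [hr, hr]
    exact h1 hxy
  have h3 : ∀ q, g' (r (h q)) = g' q := by
    intro q
    have : g (r (h q)) = g q := by rw [hr, hh]
    refine le_antisymm (not_lt.1 fun hlt => ?_) (not_lt.1 fun hlt => ?_)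
    · exact this.not_gt ((hg _ _).2 hlt)
    · exact this.not_lt ((hg _ _).2 hlt)
  have key := ha _ (θ.relabel h) _ _ h1 h2
  rw [Formula.realize_relabel, Formula.realize_relabel] at key
  convert key using 2
  · funext q; simp [hh]
  · funext q; simp [h3]

/-- The finitary form of NIP. -/
theorem FormulaNIP.exists_bound {L : FirstOrder.Language.{u, v}} {T : L.Theory} {m n : ℕ}
    {φ : L.Formula (Fin m ⊕ Fin n)} (hφ : FormulaNIP T φ) (M : Type w) [L.Structure M]
    [Nonempty M] [M ⊨ T] :
    ∃ N : ℕ, ¬ ∃ (a : Fin N → Fin m → M) (b : Set (Fin N) → Fin n → M),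
      ∀ (t : Fin N) (s : Set (Fin N)), φ.Realize (Sum.elim (a t) (b s)) ↔ t ∈ s := by
  classical
  by_contra! hcon
  let γ : ℕ × Set ℕ → L.Formula ((ℕ × Fin m) ⊕ (Set ℕ × Fin n)) := fun p =>
    let χ := φ.relabel (Sum.elim (fun i => Sum.inl (p.1, i)) (fun j => Sum.inr (p.2, j)))
    if p.1 ∈ p.2 then χ else χ.not
  obtain ⟨K, v, hv⟩ := exists_realize_of_finitely_realized.{u, v, w, 0} M γ (by
    intro G
    -- Only the `a_t` with `t < N` occur in `G`, so a shattered set of size `N` suffices; `b_s` is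
    -- interpreted by the trace of `s` on `N`.
    let N := G.sup Prod.fst + 1
    obtain ⟨a, b, hab⟩ := hcon N
    refine ⟨Sum.elim (fun p => if h : p.1 < N then a ⟨p.1, h⟩ p.2 else Classical.arbitrary M)
      (fun p => b {t | (t : ℕ) ∈ p.1} p.2), ?_⟩
    rintro ⟨t, s⟩ hts
    have ht : t < N := Nat.lt_succ_of_le (Finset.le_sup (f := Prod.fst) hts)
    have key := hab ⟨t, ht⟩ {t | (t : ℕ) ∈ s}
    have hcomp : ∀ z : (ℕ × Fin m) ⊕ (Set ℕ × Fin n) → M,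
        z ∘ (Sum.elim (fun i => Sum.inl (t, i)) (fun j => Sum.inr (s, j))) =
          Sum.elim (fun i => z (Sum.inl (t, i))) (fun j => z (Sum.inr (s, j))) := by
      intro z; funext i; cases i <;> rfl
    simp only [γ]
    split_ifs with h
    · rw [Formula.realize_relabel, hcomp]
      simpa [ht, h] using key
    · rw [Formula.realize_not, Formula.realize_relabel, hcomp]
      simpa [ht, h] using key)
  have : K ⊨ T := K.is_model.mono (Theory.completeTheory.subset)
  refine hφ (Theory.ModelType.of T K) ⟨fun t i => v (Sum.inl (t, i)),
    fun s j => v (Sum.inr (s, j)), fun t s => ?_⟩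
  have key := hv (t, s)
  have hcomp : v ∘ (Sum.elim (fun i => Sum.inl (t, i)) (fun j => Sum.inr (s, j))) =
      Sum.elim (fun i => v (Sum.inl (t, i))) (fun j => v (Sum.inr (s, j))) := by
    funext i; cases i <;> rfl
  simp only [γ] at key
  split_ifs at key with h
  · rw [Formula.realize_relabel, hcomp] at key
    exact iff_of_true key h
  · rw [Formula.realize_not, Formula.realize_relabel, hcomp] at key
    exact iff_of_false key h

/-! ### Traces of NIP formulas on the hull -/

section Hull

variable {L : FirstOrder.Language.{u, v}} {L' : FirstOrder.Language.{u', v'}} {M : Type w}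
  [L.Structure M] [L'.Structure M]
  {I : Type x} [LinearOrder I] {a : I → M} {m n k : ℕ}

/-- The trace on `k`-tuples of indices of the instances of `φ` with parameters of the form
`t(a_{i₁}, …, a_{iₖ})` belonging to the ultrafilter `U`. -/
def traceOf (a : I → M) (U : Ultrafilter (Fin n → M)) (φ : L.Formula (Fin m ⊕ Fin n))
    (t : Fin m → L'.Term (Fin k)) (i : Fin k → I) : Prop :=
  ∀ᶠ y in (U : Filter (Fin n → M)),
    φ.Realize (Sum.elim (fun l => (t l).realize (a ∘ i)) y)

/-- Over an `L'`-indiscernible sequence, the trace of an `L`-formula that is NIP has no large order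
pattern. -/
theorem no_orderPattern_traceOf (ι : L →ᴸ L') [ι.IsExpansionOn M] [Nonempty M]
    {T : L.Theory} [M ⊨ T] (ha : Indiscernible L' a) {φ : L.Formula (Fin m ⊕ Fin n)}
    (hφ : FormulaNIP T φ) (U : Ultrafilter (Fin n → M))
    (t : Fin m → L'.Term (Fin k)) :
    ∃ N, ¬ ∃ u, OrderPattern (traceOf a U φ t) N u := by
  classical
  obtain ⟨N, hN⟩ := hφ.exists_bound M
  refine ⟨N, ?_⟩
  rintro ⟨u, hu, hord⟩
  let χ : Fin N → L'.Formula ((Fin N × Fin k) ⊕ Fin n) := fun i =>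
    (ι.onFormula φ).subst (Sum.elim
      (fun l => (t l).relabel (fun z => Sum.inl (i, z))) (fun j => Term.var (Sum.inr j)))
  have hχ : ∀ (i : Fin N) (z : Fin N × Fin k → M) (y : Fin n → M),
      (χ i).Realize (Sum.elim z y) ↔
        φ.Realize (Sum.elim (fun l => (t l).realize (fun q => z (i, q))) y) := by
    intro i z y
    simp only [χ, Formula.Realize, BoundedFormula.realize_subst]
    rw [← Formula.Realize, LHom.realize_onFormula, iff_iff_eq]
    congr 1
    funext q
    cases q with
    | inl l => simp [Term.realize_relabel, Function.comp_def]
    | inr j => simp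
  let θ : (Fin N → Bool) → L'.Formula (Fin N × Fin k) := fun W =>
    Formula.iExs (Fin n) (Formula.iInf fun i : Fin N => if W i then χ i else (χ i).not)
  have hθ : ∀ W (z : Fin N × Fin k → M), (θ W).Realize z ↔ ∃ y : Fin n → M, ∀ i,
      (φ.Realize (Sum.elim (fun l => (t l).realize (fun q => z (i, q))) y) ↔ W i = true) := by
    intro W z
    simp only [θ, Formula.realize_iExs, Formula.realize_iInf]
    refine exists_congr fun y => forall_congr' fun i => ?_
    cases hW : W i
    · simp [hχ]
    · simp [hχ]
  -- The pattern `W` holds for almost all `y` at the tuples chosen by `W`, hence for some `y`.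
  -- Indiscernibility moves this existential statement to the tuples `u i true`, which do not depend
  -- on `W`.
  have hfind : ∀ W : Fin N → Bool, (θ W).Realize (a ∘ fun q => u q.1 true q.2) := by
    intro W
    rw [ha.realize_iff (θ W) (g' := fun q => u q.1 (W q.1) q.2)
      (fun q q' => hord (fun _ => true) W q.1 q'.1 q.2 q'.2), hθ]
    have : ∀ᶠ y in (U : Filter (Fin n → M)), ∀ i,
        (φ.Realize (Sum.elim (fun l => (t l).realize (a ∘ u i (W i))) y) ↔ W i = true) := by
      rw [Filter.eventually_all]
      intro i
      cases hW : W i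
      · have := (hu i).2
        rw [traceOf, ← Ultrafilter.eventually_not] at this
        filter_upwards [this] with y hy
        simpa using hy
      · have := (hu i).1
        rw [traceOf] at this
        filter_upwards [this] with y hy
        simpa using hy
    exact this.exists
  choose b hb using fun s : Set (Fin N) => (hθ _ _).1 (hfind fun i => decide (i ∈ s))
  refine hN ⟨fun i l => (t l).realize (a ∘ u i true), b, fun i s => ?_⟩
  have := hb s i
  rwa [decide_eq_true_iff] at this

end Hull

/-! ### Coding and counting types -/

/-- Every complete type over `A ⊆ M` is the type of an ultrafilter on the tuples of `M`. -/
theorem exists_ultrafilter_of_completeType {L : FirstOrder.Language.{u, v}} {M : Type w}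
    [L.Structure M] [Nonempty M] {α : Type w'} [Finite α] (p : (L.completeTheory M).CompleteType α) :
    ∃ U : Ultrafilter (α → M), ∀ ψ : L.Formula α,
      Formula.equivSentence ψ ∈ p ↔ ∀ᶠ y in (U : Filter (α → M)), ψ.Realize y := by
  classical
  obtain ⟨K, v, rfl⟩ := Theory.exists_modelType_is_realized_in _ p
  let S : Set (Set (α → M)) := {s | ∃ ψ : L.Formula α, ψ.Realize v ∧ s = {y | ψ.Realize y}}
  -- For finitely many formulas true of `v`, the existential closure of their conjunction belongs to
  -- the complete theory of `M`, so they have a common solution in `M`.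
  obtain ⟨U, hU⟩ := Ultrafilter.exists_ultrafilter_of_finite_inter_nonempty S (by
    intro F hF
    have hF' : ∀ s ∈ F, ∃ ψ : L.Formula α, ψ.Realize v ∧ s = {y | ψ.Realize y} := fun s hs => hF hs
    choose! ψ hψ hs using hF'
    let θ : L.Sentence := Formula.iExs α
      ((Formula.iInf fun s : F => ψ s.1).relabel (Sum.inr : α → Empty ⊕ α))
    have hK : K ⊨ θ := by
      rw [Sentence.Realize, Formula.realize_iExs]
      refine ⟨v, ?_⟩
      rw [Formula.realize_relabel, Formula.realize_iInf]
      exact fun s => hψ s.1 s.2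
    have hM : M ⊨ θ := (realize_iff_of_model_completeTheory M K θ).1 hK
    rw [Sentence.Realize, Formula.realize_iExs] at hM
    obtain ⟨y, hy⟩ := hM
    rw [Formula.realize_relabel, Formula.realize_iInf] at hy
    refine ⟨y, fun s hsF => ?_⟩
    rw [hs s hsF]
    exact hy ⟨s, hsF⟩)
  have key : ∀ ψ : L.Formula α, ψ.Realize v → ∀ᶠ y in (U : Filter (α → M)), ψ.Realize y :=
    fun ψ hψ => hU ⟨ψ, hψ, rfl⟩
  refine ⟨U, fun ψ => ?_⟩
  rw [Theory.CompleteType.formula_mem_typeOf]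
  refine ⟨key ψ, fun h => ?_⟩
  by_contra hcon
  have := key ψ.not hcon
  simp only [Formula.realize_not] at this
  rw [Ultrafilter.eventually_not] at this
  exact this h

theorem sum_nat_le {f : ℕ → Cardinal.{u}} {c : Cardinal.{u}} (hc : ℵ₀ ≤ c) (hf : ∀ n, f n ≤ c) :
    Cardinal.sum f ≤ c := by
  refine (sum_le_sum _ (fun _ => c) hf).trans ?_
  rw [sum_const, mk_nat, lift_aleph0, lift_uzero]
  exact mul_le_of_le hc hc le_rfl

theorem mk_sigma_nat_le {F : ℕ → Type u} {c : Cardinal.{u}} (hc : ℵ₀ ≤ c) (hF : ∀ n, #(F n) ≤ c) :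
    #(Σ n, F n) ≤ c := by
  rw [mk_sigma]
  exact sum_nat_le hc hF

theorem mk_fin_arrow_le {α : Type u} {c : Cardinal.{u}} (hc : ℵ₀ ≤ c) (hα : #α ≤ c) (n : ℕ) :
    #(Fin n → α) ≤ c := by
  have : #(Fin n → α) = #α ^ n := by simp
  rw [this]
  exact (pow_le_pow_left' hα n).trans (power_nat_le hc)

theorem mk_formula_le {L : FirstOrder.Language.{u, v}} {c : Cardinal.{max u v}} (hc : ℵ₀ ≤ c)
    (hL : L.card ≤ c) (α : Type) [Countable α] : #(L.Formula α) ≤ c := by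
  have h1 : #(L.Formula α) ≤ #(Σ n, L.BoundedFormula α n) :=
    mk_le_of_injective (f := fun φ : L.Formula α => (⟨0, φ⟩ : Σ n, L.BoundedFormula α n))
      (fun φ ψ h => by simpa using h)
  refine h1.trans (BoundedFormula.card_le.trans (max_le hc (add_le_of_le hc ?_ ?_)))
  · exact (lift_le_aleph0.2 mk_le_aleph0).trans hc
  · simpa using hL

theorem mk_term_le {L : FirstOrder.Language.{u, v}} {c : Cardinal.{max u v}} (hc : ℵ₀ ≤ c)
    (hL : L.card ≤ c) (α : Type) [Countable α] : lift.{v} #(L.Term α) ≤ c := by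
  have h := lift_le.{v}.2 (Term.card_le (L := L) (α := α))
  refine h.trans ?_
  rw [lift_max, lift_aleph0, mk_sum, lift_add]
  refine max_le hc (add_le_of_le hc ?_ ?_)
  · exact (lift_le_aleph0.2 (lift_le_aleph0.2 mk_le_aleph0)).trans hc
  · rw [card_eq_card_functions_add_card_relations] at hL
    exact (le_trans (by simp) (self_le_add_right _ _)).trans hL

/-- An instance of an `L`-formula over `A`, when `A` is contained in the `L'`-hull of `a`, is an
instance of an `L`-formula at terms in an increasing tuple from `a`. -/
theorem exists_realize_iff_of_hull {L : FirstOrder.Language.{u, v}}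
    {L' : FirstOrder.Language.{max u v, v}} {M : Type w} [L.Structure M] [L'.Structure M]
    {I : Type x} [LinearOrder I] {a : I → M} {A : Set M}
    (hA : ∀ y ∈ A, ∃ t : L'.Term I, t.realize a = y) {n : ℕ} (ψ : L[[A]].Formula (Fin n)) :
    ∃ (m k : ℕ) (φ : L.Formula (Fin m ⊕ Fin n)) (t : Fin m → L'.Term (Fin k)) (i : Fin k → I),
      StrictMono i ∧ ∀ y : Fin n → M,
        ψ.Realize y ↔ φ.Realize (Sum.elim (fun l => (t l).realize (a ∘ i)) y) := by
  classical
  let χ : L.Formula (A ⊕ Fin n) := BoundedFormula.constantsVarsEquiv ψ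
  have hχ : ∀ y : Fin n → M, ψ.Realize y ↔ χ.Realize (Sum.elim (fun b : A => (b : M)) y) :=
    fun y => BoundedFormula.realize_constantsVarsEquiv.symm
  let G := χ.freeVarFinset.toLeft
  choose s hs using fun l : Fin G.card => hA _ (G.equivFin.symm l).1.2
  let V : Finset I := Finset.univ.biUnion fun l => (s l).varFinset
  have hV : ∀ l, ∀ z ∈ (s l).varFinset, z ∈ V := fun l z hz =>
    Finset.mem_biUnion.2 ⟨l, Finset.mem_univ l, hz⟩
  let e : Fin V.card ≃o V := V.orderIsoOfFin rfl
  refine ⟨G.card, V.card, χ.restrictFreeVar fun z => match z with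
    | ⟨Sum.inl b, h⟩ => Sum.inl (G.equivFin ⟨b, Finset.mem_toLeft.2 h⟩)
    | ⟨Sum.inr j, _⟩ => Sum.inr j,
    fun l => (s l).restrictVar fun z => e.symm ⟨z, hV l z z.2⟩, fun z => e z,
    fun z z' h => e.strictMono h, fun y => ?_⟩
  have ht : ∀ l, ((s l).restrictVar fun z => e.symm ⟨z, hV l z z.2⟩).realize
      (a ∘ fun z => (e z : I)) = ((G.equivFin.symm l).1 : M) := by
    intro l
    rw [Term.realize_restrictVar a (by intro z; simp), hs]
  rw [hχ, Formula.Realize, Formula.Realize]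
  refine (BoundedFormula.realize_restrictFreeVar _ ?_).symm
  rintro ⟨z | j, h⟩
  · simp only [Sum.elim_inl, ht, Equiv.symm_apply_apply]
  · rfl

/-- In a NIP theory there are few types over subsets of the hull of a well-ordered indiscernible
sequence. -/
theorem card_allTypesOver_le {L : FirstOrder.Language.{u, v}}
    {L' : FirstOrder.Language.{max u v, v}} (ι : L →ᴸ L') {T : L.Theory} (hT : TheoryNIP T)
    {c : Cardinal.{max u v}} (hc : ℵ₀ ≤ c) (hL : L.card ≤ c) (hL' : L'.card ≤ c)
    {M : Type (max u v w)} [L.Structure M] [L'.Structure M] [ι.IsExpansionOn M] [Nonempty M]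
    [M ⊨ T] {J : Type (max u v w)} [LinearOrder J] [WellFoundedLT J] {a : J → M}
    (ha : Indiscernible L' a) (hgen : Substructure.closure L' (Set.range a) = ⊤) (A : Set M)
    (hA : 2 ≤ #A) : #(AllTypesOver L A) ≤ #A ^ lift.{w} c := by
  classical
  have hterm : ∀ y : M, ∃ t : L'.Term J, t.realize a = y := by
    intro y
    have hy : y ∈ Substructure.closure L' (Set.range a) := hgen ▸ Substructure.mem_top y
    obtain ⟨t, ht⟩ := Substructure.mem_closure_iff_exists_term.1 hy
    choose g hg using fun z : Set.range a => z.2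
    refine ⟨t.relabel g, ?_⟩
    rw [Term.realize_relabel, ← ht]
    congr 1
    funext z
    exact hg z
  choose s hs using hterm
  let I : Set J := ⋃ y : A, ((s y).varFinset : Set J)
  have hI : #I ≤ max ℵ₀ #A := by
    refine (mk_iUnion_le_sum_mk).trans ((sum_le_sum _ (fun _ => ℵ₀) fun y => ?_).trans ?_)
    · exact (lt_aleph0_of_finite _).le
    · rw [sum_const]
      simp only [lift_id]
      exact mul_le_of_le (le_max_left _ _) (le_max_right _ _) (le_max_left _ _)
  have hAI : ∀ y ∈ A, ∃ t : L'.Term I, t.realize (a ∘ (↑)) = y := fun y hy =>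
    ⟨(s y).restrictVar (Set.inclusion (Set.subset_iUnion
      (fun y : A => ((s y).varFinset : Set J)) ⟨y, hy⟩)), by
      rw [Term.realize_restrictVar', hs]⟩
  have haI : Indiscernible L' (a ∘ ((↑) : I → J)) := fun n φ i j hi hj =>
    ha n φ _ _ (fun _ _ h => hi h) (fun _ _ h => hj h)
  set b : I → M := a ∘ (↑) with hb
  -- A code lists the finite set `D` and the positions relative to `D` of the tuples in the trace.
  let Code : Type (max u v w) :=
    Σ k : ℕ, Σ r : ℕ, (Fin r → I) × Set (Fin k → Fin r → Ordering)
  have hCode : #Code ≤ max ℵ₀ #A := by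
    refine mk_sigma_nat_le (le_max_left _ _) fun k => mk_sigma_nat_le (le_max_left _ _) fun r => ?_
    rw [mk_prod, lift_uzero]
    refine mul_le_of_le (le_max_left _ _) (mk_fin_arrow_le (le_max_left _ _) hI r) ?_
    exact le_max_of_le_left (lift_le_aleph0.2 mk_le_aleph0)
  have hcA : ℵ₀ ≤ #A ^ lift.{w} c := by
    refine ((aleph0_le_lift.2 hc).trans (cantor _).le).trans ?_
    exact power_le_power_right hA
  -- For finite `A` the extra `ℵ₀` is absorbed by the exponent, using `2 ≤ #A`.
  have hbound : (max ℵ₀ #A) ^ lift.{w} c ≤ #A ^ lift.{w} c := by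
    rcases le_total ℵ₀ #A with h | h
    · rw [max_eq_right h]
    · rw [max_eq_left h]
      calc ℵ₀ ^ lift.{w} c ≤ (2 ^ lift.{w} c) ^ lift.{w} c :=
            power_le_power_right ((aleph0_le_lift.2 hc).trans (cantor _).le)
        _ = 2 ^ lift.{w} c := by
            rw [← power_mul, mul_eq_self (aleph0_le_lift.2 hc)]
        _ ≤ _ := power_le_power_right hA
  refine mk_sigma_nat_le hcA fun n => ?_
  let Idx : Type (max u v) :=
    Σ m : ℕ, Σ k : ℕ, L.Formula (Fin m ⊕ Fin n) × (Fin m → L'.Term (Fin k))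
  have hIdx : #Idx ≤ c := by
    refine mk_sigma_nat_le hc fun m => mk_sigma_nat_le hc fun k => ?_
    rw [mk_prod, lift_id, lift_id]
    refine mul_le_of_le hc (mk_formula_le hc hL _) (mk_fin_arrow_le hc ?_ m)
    have := mk_term_le hc hL' (Fin k)
    rwa [lift_id'.{v, max u v}] at this
  -- The ultrafilter decides instances at all terms in the sequence, so traces are defined even
  -- where these terms take values outside `A`.
  choose U hU using fun p : TypesOver L A n => exists_ultrafilter_of_completeType p
  have hcode : ∀ (p : TypesOver L A n) (x : Idx),
      ∃ d : Σ r : ℕ, (Fin r → I) × Set (Fin x.2.1 → Fin r → Ordering),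
        ∀ i : Fin x.2.1 → I, StrictMono i →
          (traceOf b (U p) x.2.2.1 x.2.2.2 i ↔ (fun l z => cmp (i l) (d.2.1 z)) ∈ d.2.2) := by
    intro p x
    obtain ⟨N, hN⟩ := no_orderPattern_traceOf ι haI (hT _ _ x.2.2.1) (U p) x.2.2.2
    obtain ⟨D, hD⟩ := exists_finset_of_no_orderPattern hN
    let d : Fin D.card → I := fun z => (D.equivFin.symm z).1
    refine ⟨⟨D.card, d, {τ | ∃ i : Fin x.2.1 → I, StrictMono i ∧
      traceOf b (U p) x.2.2.1 x.2.2.2 i ∧ (fun l z => cmp (i l) (d z)) = τ}⟩, ?_⟩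
    intro i hi
    constructor
    · exact fun h => ⟨i, hi, h, rfl⟩
    · rintro ⟨j, hj, hf, hτ⟩
      refine (hD j i hj hi fun l z hz => ?_).1 hf
      have := congrFun (congrFun hτ l) (D.equivFin ⟨z, hz⟩)
      simpa [d] using this
  choose code hcode using hcode
  have hinj : Function.Injective (fun (p : TypesOver L A n) (x : Idx) =>
      (⟨x.2.1, code p x⟩ : Code)) := by
    intro p q hpq
    have hpq' : ∀ x, code p x = code q x := fun x => by
      simpa using congrFun hpq x
    refine SetLike.ext fun σ => ?_
    obtain ⟨ψ, rfl⟩ := Formula.equivSentence.surjective σ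
    obtain ⟨m, k, φ, t, i, hi, hψ⟩ := exists_realize_iff_of_hull hAI ψ
    rw [hU, hU]
    simp only [hψ]
    have h1 := hcode p ⟨m, k, φ, t⟩ i hi
    have h2 := hcode q ⟨m, k, φ, t⟩ i hi
    rw [hpq'] at h1
    exact h1.trans h2.symm
  refine (mk_le_of_injective hinj).trans ?_
  rw [mk_arrow, lift_id', lift_umax.{max u v, w}]
  calc #Code ^ lift.{w} #Idx ≤ (max ℵ₀ #A) ^ lift.{w} #Idx := power_le_power_right hCode
    _ ≤ (max ℵ₀ #A) ^ lift.{w} c := by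
      refine power_le_power_left ?_ (lift_le.2 hIdx)
      exact (aleph0_pos.trans_le (le_max_left _ _)).ne'
    _ ≤ _ := hbound

/-! ### Skolemization in a single language -/

section Skolem

variable (L : FirstOrder.Language.{u, v})

/-- A set of names for the formulas of the Skolemization. -/
def SkolemIndex : Type (max u v) := (max ℵ₀ L.card).out

theorem mk_skolemIndex : #(SkolemIndex L) = max ℵ₀ L.card := mk_out _

/-- The language obtained from `L` by adding function symbols `(j, x)` of each arity, where `j` is
the stage at which the symbol is introduced and `x` names a formula. -/
def skolemLanguage : FirstOrder.Language.{max u v, v} :=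
  ⟨fun n => ULift.{v} (L.Functions n) ⊕ (ℕ × SkolemIndex L), L.Relations⟩

/-- The inclusion of `L` into its Skolem language. -/
def skolemInclusion : L →ᴸ skolemLanguage L :=
  ⟨fun _ f => Sum.inl ⟨f⟩, fun _ r => r⟩

theorem skolemInclusion_injective : (skolemInclusion L).Injective :=
  ⟨fun h => ULift.up_injective (Sum.inl_injective h), fun h => h⟩

theorem card_skolemLanguage_le : (skolemLanguage L).card ≤ max ℵ₀ L.card := by
  have hc : ℵ₀ ≤ max ℵ₀ L.card := le_max_left _ _
  have hfun (n : ℕ) : lift.{v} #(L.Functions n) ≤ max ℵ₀ L.card := by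
    rw [card_eq_card_functions_add_card_relations]
    exact ((le_sum _ n).trans (self_le_add_right _ _)).trans (le_max_right _ _)
  have hrel (n : ℕ) : lift.{u} #(L.Relations n) ≤ max ℵ₀ L.card := by
    rw [card_eq_card_functions_add_card_relations]
    exact ((le_sum (fun n => lift.{u} #(L.Relations n)) n).trans (self_le_add_left _ _)).trans
      (le_max_right _ _)
  rw [card_eq_card_functions_add_card_relations]
  refine add_le_of_le hc (sum_nat_le hc fun n => ?_) (sum_nat_le hc fun n => ?_)
  · change lift.{v} #(ULift.{v} (L.Functions n) ⊕ (ℕ × SkolemIndex L)) ≤ _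
    rw [lift_id'.{v, max u v}, mk_sum, lift_id, lift_id, mk_prod, lift_id'.{0, max u v},
      mk_skolemIndex, mk_nat, lift_aleph0, mk_uLift]
    exact add_le_of_le hc (hfun n) (mul_le_of_le hc hc le_rfl)
  · rw [lift_umax.{v, u}]
    exact hrel n

variable {L}

/-- The stage at which a function symbol is available. -/
def functionRank {n : ℕ} : (skolemLanguage L).Functions n → ℕ
  | Sum.inl _ => 0
  | Sum.inr p => p.1 + 1

/-- The stage at which a term is available. -/
def termRank {α : Type*} : (skolemLanguage L).Term α → ℕ
  | Term.var _ => 0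
  | Term.func f ts => max (functionRank f) (Finset.univ.sup fun i => termRank (ts i))

/-- The stage at which a formula is available. -/
def formulaRank {α : Type*} : ∀ {n : ℕ}, (skolemLanguage L).BoundedFormula α n → ℕ
  | _, BoundedFormula.falsum => 0
  | _, BoundedFormula.equal t s => max (termRank t) (termRank s)
  | _, BoundedFormula.rel _ ts => Finset.univ.sup fun i => termRank (ts i)
  | _, BoundedFormula.imp φ ψ => max (formulaRank φ) (formulaRank ψ)
  | _, BoundedFormula.all φ => formulaRank φ

/-- An interpretation of the new function symbols of the Skolem language. -/
abbrev SkolemInterp (L : FirstOrder.Language.{u, v}) (N : Type w) :=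
  ∀ n : ℕ, ℕ → SkolemIndex L → (Fin n → N) → N

variable {N : Type w} [L.Structure N]

/-- The expansion of an `L`-structure determined by an interpretation of the new symbols. -/
@[reducible]
def skolemStructure (σ : SkolemInterp L N) : (skolemLanguage L).Structure N where
  funMap {n} f x := match f with
    | Sum.inl f => Structure.funMap f.down x
    | Sum.inr p => σ n p.1 p.2 x
  RelMap {_} r x := Structure.RelMap (L := L) r x

theorem skolemStructure_isExpansionOn (σ : SkolemInterp L N) :
    @LHom.IsExpansionOn _ _ (skolemInclusion L) N _ (skolemStructure σ) :=
  let _ := skolemStructure σ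
  ⟨fun _ _ => rfl, fun _ _ => rfl⟩

/-- A new symbol of stage `j` has rank `j + 1`, so a term of rank at most `r` uses only new symbols
of stage below `r`. -/
theorem realize_term_congr {σ τ : SkolemInterp L N} {r : ℕ}
    (h : ∀ n, ∀ j < r, σ n j = τ n j) {α : Type*} (v : α → N) (t : (skolemLanguage L).Term α)
    (ht : termRank t ≤ r) :
    @Term.realize _ N (skolemStructure σ) _ v t = @Term.realize _ N (skolemStructure τ) _ v t := by
  induction t with
  | var => rfl
  | func f ts ih =>
    rw [termRank, max_le_iff, Finset.sup_le_iff] at ht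
    have hts : (fun i => @Term.realize _ N (skolemStructure σ) _ v (ts i)) =
        fun i => @Term.realize _ N (skolemStructure τ) _ v (ts i) :=
      funext fun i => ih i (ht.2 i (Finset.mem_univ i))
    simp only [Term.realize, hts]
    rcases f with f | ⟨j, x⟩
    · rfl
    · exact congrFun (congrFun (h _ j ht.1) x) _

theorem realize_formula_congr {σ τ : SkolemInterp L N} {r : ℕ}
    (h : ∀ n, ∀ j < r, σ n j = τ n j) {α : Type*} {n : ℕ}
    (φ : (skolemLanguage L).BoundedFormula α n) (hφ : formulaRank φ ≤ r) (v : α → N)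
    (x : Fin n → N) :
    @BoundedFormula.Realize _ N (skolemStructure σ) _ _ φ v x ↔
      @BoundedFormula.Realize _ N (skolemStructure τ) _ _ φ v x := by
  induction φ with
  | falsum => rfl
  | equal t s =>
    rw [formulaRank, max_le_iff] at hφ
    simp only [BoundedFormula.Realize]
    rw [realize_term_congr h _ t hφ.1, realize_term_congr h _ s hφ.2]
  | rel R ts =>
    rw [formulaRank, Finset.sup_le_iff] at hφ
    simp only [BoundedFormula.Realize]
    rw [show (fun i => @Term.realize _ N (skolemStructure σ) _ (Sum.elim v x) (ts i)) =
      fun i => @Term.realize _ N (skolemStructure τ) _ (Sum.elim v x) (ts i) from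
      funext fun i => realize_term_congr h _ _ (hφ i (Finset.mem_univ i))]
    rfl
  | imp φ ψ ih1 ih2 =>
    rw [formulaRank, max_le_iff] at hφ
    simp only [BoundedFormula.Realize]
    rw [ih1 hφ.1, ih2 hφ.2]
  | all φ ih =>
    rw [formulaRank] at hφ
    simp only [BoundedFormula.Realize]
    exact forall_congr' fun y => ih hφ _

/-- The enlarged language still has at most `|T|` formulas, so the names suffice for its own
formulas and no tower of languages is needed. The stage in each symbol prevents circularity. -/
theorem exists_code :
    Nonempty ((Σ n, (skolemLanguage L).Formula (Fin (n + 1))) ↪ SkolemIndex L) := by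
  rw [← Cardinal.le_def, mk_skolemIndex]
  exact mk_sigma_nat_le (le_max_left _ _) fun n =>
    mk_formula_le (le_max_left _ _) (card_skolemLanguage_le L) _

/-- The name of a formula. -/
noncomputable def skolemCode :
    (Σ n, (skolemLanguage L).Formula (Fin (n + 1))) ↪ SkolemIndex L :=
  exists_code.some

/-- The Skolem term of a formula. -/
noncomputable def skolemTerm {n : ℕ} (φ : (skolemLanguage L).Formula (Fin (n + 1))) :
    (skolemLanguage L).Term (Fin n) :=
  Term.func (show (skolemLanguage L).Functions n from
    Sum.inr (formulaRank φ, skolemCode ⟨n, φ⟩)) Term.var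

/-- The statement that the Skolem term of `φ` finds a witness for the last variable of `φ`. -/
noncomputable def skolemSentence {n : ℕ} (φ : (skolemLanguage L).Formula (Fin (n + 1))) :
    (skolemLanguage L).Sentence :=
  Formula.iAlls (Fin (n + 1)) (Formula.relabel Sum.inr (φ.imp (φ.subst
    (Fin.snoc (α := fun _ => (skolemLanguage L).Term (Fin (n + 1)))
      (fun i => Term.var i.castSucc) ((skolemTerm φ).relabel Fin.castSucc)))))

/-- The Skolemization of a theory. -/
def skolemTheory (T : L.Theory) : (skolemLanguage L).Theory :=
  (skolemInclusion L).onTheory T ∪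
    Set.range fun p : Σ n, (skolemLanguage L).Formula (Fin (n + 1)) => skolemSentence p.2

theorem realize_skolemSentence {n : ℕ} (φ : (skolemLanguage L).Formula (Fin (n + 1))) (K : Type w)
    [(skolemLanguage L).Structure K] :
    K ⊨ skolemSentence φ ↔ ∀ (x : Fin n → K) (y : K), φ.Realize (Fin.snoc x y : Fin (n + 1) → K) →
      φ.Realize (Fin.snoc x ((skolemTerm φ).realize x) : Fin (n + 1) → K) := by
  have key : ∀ z : Fin (n + 1) → K, (φ.subst
      (Fin.snoc (α := fun _ => (skolemLanguage L).Term (Fin (n + 1)))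
        (fun i => Term.var i.castSucc) ((skolemTerm φ).relabel Fin.castSucc))).Realize z
        (default : Fin 0 → K) ↔
      φ.Realize (Fin.snoc (Fin.init z) ((skolemTerm φ).realize (Fin.init z)) :
        Fin (n + 1) → K) := by
    intro z
    rw [BoundedFormula.realize_subst, Formula.Realize, iff_iff_eq]
    congr 1
    funext i
    refine Fin.lastCases ?_ (fun i => ?_) i
    · simp only [Fin.snoc_last, Term.realize_relabel]
      rfl
    · simp only [Fin.snoc_castSucc, Term.realize_var]
      rfl
  rw [skolemSentence, Sentence.Realize, Formula.realize_iAlls]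
  constructor
  · intro h x y hxy
    have := h (Fin.snoc x y)
    rw [Formula.realize_relabel] at this
    have := (key (Fin.snoc x y)).1 (this hxy)
    rwa [Fin.init_snoc] at this
  · intro h z
    rw [Formula.realize_relabel]
    intro hz
    refine (key _).2 (h (Fin.init z) (z (Fin.last n)) ?_)
    rwa [Fin.snoc_init_self]

variable [Nonempty N]

/-- One step in the construction of Skolem functions: choose witnesses according to a given
interpretation. -/
noncomputable def skolemChoice (σ : SkolemInterp L N) (n : ℕ) (x : SkolemIndex L)
    (v : Fin n → N) : N :=
  Classical.epsilon fun y => ∃ φ : (skolemLanguage L).Formula (Fin (n + 1)),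
    skolemCode ⟨n, φ⟩ = x ∧
      @Formula.Realize _ N (skolemStructure σ) _ φ (Fin.snoc v y : Fin (n + 1) → N)

variable (L N)

/-- The interpretation of the new symbols of rank at most `j`. -/
noncomputable def skolemStage : ℕ → SkolemInterp L N
  | 0 => fun _ _ _ _ => Classical.arbitrary N
  | j + 1 => fun n i x => if i = j then skolemChoice (skolemStage j) n x else skolemStage j n i x

/-- The interpretation of the new symbols by Skolem functions. -/
noncomputable def skolemInterp : SkolemInterp L N := fun n j x => skolemStage L N (j + 1) n j x

variable {L N}

/-- Symbols of stage `j` receive their meaning at step `j + 1` and later steps leave it alone. -/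
theorem skolemStage_eq_skolemInterp (r n j : ℕ) (h : j < r) :
    skolemStage L N r n j = skolemInterp L N n j := by
  induction r with
  | zero => omega
  | succ r ih =>
    rcases Nat.lt_succ_iff_lt_or_eq.1 h with h' | rfl
    · rw [← ih h']
      funext x
      simp [skolemStage, h'.ne]
    · rfl

/-- The Skolem function of `φ` is chosen at stage `formulaRank φ`, when all symbols in `φ` already
have their final meaning. The chosen witness therefore remains one. -/
theorem model_skolemTheory (T : L.Theory) [N ⊨ T] :
    @Theory.Model _ N (skolemStructure (skolemInterp L N)) (skolemTheory T) := by
  let _ := skolemStructure (skolemInterp L N)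
  have := skolemStructure_isExpansionOn (skolemInterp L N)
  refine Theory.Model.union ((LHom.onTheory_model _ _).2 inferInstance) ?_
  rw [Theory.model_iff]
  rintro _ ⟨⟨n, φ⟩, rfl⟩
  rw [realize_skolemSentence]
  intro x y hxy
  have hcongr : ∀ z : Fin (n + 1) → N,
      @Formula.Realize _ N (skolemStructure (skolemStage L N (formulaRank φ))) _ φ z ↔
        φ.Realize z := fun z =>
    realize_formula_congr (fun n j hj => skolemStage_eq_skolemInterp _ n j hj) φ le_rfl _ _
  have hterm : (skolemTerm φ).realize x =
      skolemChoice (skolemStage L N (formulaRank φ)) n (skolemCode ⟨n, φ⟩) x := by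
    change skolemStage L N (formulaRank φ + 1) n (formulaRank φ) (skolemCode ⟨n, φ⟩) x = _
    simp [skolemStage]
  obtain ⟨φ', hφ', h⟩ := Classical.epsilon_spec (p := fun y : N =>
    ∃ ψ : (skolemLanguage L).Formula (Fin (n + 1)), skolemCode ⟨n, ψ⟩ = skolemCode ⟨n, φ⟩ ∧
      @Formula.Realize _ N (skolemStructure (skolemStage L N (formulaRank φ))) _ ψ
        (Fin.snoc x y : Fin (n + 1) → N)) ⟨y, φ, rfl, (hcongr _).2 hxy⟩
  have : φ' = φ := by simpa using skolemCode.injective hφ'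
  subst this
  rw [hterm]
  exact (hcongr _).1 h

end Skolem

theorem isSkolemization_skolemTheory {L : FirstOrder.Language.{u, v}} (T : L.Theory) :
    IsSkolemization.{u, v, w} (skolemInclusion L) T (skolemTheory T) where
  injective := skolemInclusion_injective L
  card_le := card_skolemLanguage_le L
  extends_theory := Set.subset_union_left
  expands N := ⟨skolemStructure (skolemInterp L N), skolemStructure_isExpansionOn _,
    model_skolemTheory T⟩
  skolem n φ := ⟨skolemTerm φ, fun K => (realize_skolemSentence φ K).1
    (K.is_model.realize_of_mem _ (Or.inr ⟨⟨n, φ⟩, rfl⟩))⟩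

/-! ### Indiscernible sequences from powers of an ultrafilter -/

/-- The `n`-fold product of an ultrafilter with itself. -/
def ultrafilterPower {N : Type w} (U : Ultrafilter N) : ∀ n : ℕ, Ultrafilter (Fin n → N)
  | 0 => pure default
  | n + 1 => U.bind fun x => (ultrafilterPower U n).map fun y => (Fin.cons x y : Fin (n + 1) → N)

theorem mem_ultrafilterPower_succ {N : Type w} (U : Ultrafilter N) {n : ℕ}
    {s : Set (Fin (n + 1) → N)} :
    s ∈ ultrafilterPower U (n + 1) ↔
      ∀ᶠ x in (U : Filter N), {y | (Fin.cons x y : Fin (n + 1) → N) ∈ s} ∈ ultrafilterPower U n :=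
  Iff.rfl

/-- The coordinate projections along increasing maps preserve the powers of an ultrafilter. -/
theorem preimage_mem_ultrafilterPower {N : Type w} (U : Ultrafilter N) {n r : ℕ} {i : Fin n → Fin r}
    (hi : StrictMono i) {s : Set (Fin n → N)} (hs : s ∈ ultrafilterPower U n) :
    {z : Fin r → N | z ∘ i ∈ s} ∈ ultrafilterPower U r := by
  induction r generalizing n with
  | zero =>
    cases n with
    | zero =>
      convert hs using 1
      ext z
      rw [Set.mem_ofPred_eq, Subsingleton.elim (z ∘ i) z]
    | succ n => exact (i 0).elim0
  | succ r ih =>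
    rw [mem_ultrafilterPower_succ]
    cases n with
    | zero =>
      have key : ∀ z : Fin 0 → N, z ∈ s := fun z => by
        obtain ⟨z', hz'⟩ := Ultrafilter.nonempty_of_mem hs
        rwa [Subsingleton.elim z z']
      refine Filter.Eventually.of_forall fun x => ?_
      exact Filter.mem_of_superset Filter.univ_mem fun y _ => key _
    | succ n =>
      -- If `i` uses coordinate `0`, strip it from both tuples; otherwise coordinate `0` of the
      -- longer tuple is irrelevant.
      by_cases h0 : i 0 = 0
      · have hne : ∀ l : Fin n, i l.succ ≠ 0 := fun l => by
          have : i 0 < i l.succ := hi (Fin.succ_pos l)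
          rw [h0] at this
          exact this.ne'
        let i' : Fin n → Fin r := fun l => (i l.succ).pred (hne l)
        have hi' : StrictMono i' := fun l l' h =>
          Fin.pred_lt_pred_iff.2 (hi (Fin.succ_lt_succ_iff.2 h))
        rw [mem_ultrafilterPower_succ] at hs
        filter_upwards [hs] with x hx
        convert ih hi' hx using 1
        ext y
        simp only [Set.mem_ofPred_eq]
        rw [iff_iff_eq]
        congr 1
        funext l
        refine Fin.cases ?_ (fun l => ?_) l
        · simp [h0]
        · have : i l.succ = (i' l).succ := by simp [i']
          simp [this]
      · have hne : ∀ l, i l ≠ 0 := fun l => by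
          have : 0 < i 0 := Fin.pos_iff_ne_zero.2 h0
          exact (this.trans_le (hi.monotone (Fin.zero_le l))).ne'
        let i' : Fin (n + 1) → Fin r := fun l => (i l).pred (hne l)
        have hi' : StrictMono i' := fun l l' h => Fin.pred_lt_pred_iff.2 (hi h)
        refine Filter.Eventually.of_forall fun x => ?_
        convert ih hi' hs using 1
        ext y
        simp only [Set.mem_ofPred_eq]
        rw [iff_iff_eq]
        congr 1
        funext l
        have : i l = (i' l).succ := by simp [i']
        simp [this]

/-- Every infinite structure has elementarily equivalent structures with indiscernible sequences of
distinct elements along any linear order. -/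
theorem exists_indiscernible {L : FirstOrder.Language.{u, v}} (N : Type w) [L.Structure N]
    [Infinite N] (J : Type w') [LinearOrder J] :
    ∃ (K : Theory.ModelType.{u, v, max u v w'} (L.completeTheory N)) (a : J → K),
      Function.Injective a ∧ Indiscernible L a := by
  classical
  let P := ultrafilterPower (Filter.hyperfilter N)
  -- Ask every increasing tuple to satisfy all formulas that hold almost everywhere for the
  -- ultrafilter power. Since that power decides each formula, indiscernibility follows.
  let β := {p : Σ n : ℕ, L.Formula (Fin n) × (Fin n → J) //
    StrictMono p.2.2 ∧ {y | p.2.1.Realize y} ∈ P p.1}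
  have : Nonempty β := ⟨⟨⟨0, ⊤, Fin.elim0⟩, fun l => l.elim0,
    Filter.mem_of_superset Filter.univ_mem fun y _ => by simp⟩⟩
  obtain ⟨K, a, ha⟩ := exists_realize_of_finitely_realized.{u, v, w, w'} N
      (fun p : β => p.1.2.1.relabel p.1.2.2) (by
    intro G
    let V : Finset J := G.biUnion fun p => Finset.univ.image p.1.2.2
    let e : Fin V.card ≃o V := V.orderIsoOfFin rfl
    have hV : ∀ p : G, ∀ l, p.1.1.2.2 l ∈ V := fun p l =>
      Finset.mem_biUnion.2 ⟨p.1, p.2, Finset.mem_image_of_mem _ (Finset.mem_univ l)⟩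
    have hev : ∀ᶠ z in (P V.card : Filter (Fin V.card → N)), ∀ p : G,
        p.1.1.2.1.Realize (z ∘ fun l => e.symm ⟨p.1.1.2.2 l, hV p l⟩) := by
      rw [Filter.eventually_all]
      intro p
      exact preimage_mem_ultrafilterPower _
        (fun l l' h => e.symm.strictMono (show _ < _ from p.1.2.1 h)) p.1.2.2
    obtain ⟨z, hz⟩ := hev.exists
    refine ⟨fun j => if h : j ∈ V then z (e.symm ⟨j, h⟩) else Classical.arbitrary N,
      fun p hp => ?_⟩
    rw [Formula.realize_relabel]
    convert hz ⟨p, hp⟩ using 1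
    funext l
    simp [hV ⟨p, hp⟩ l])
  have key : ∀ {n : ℕ} (φ : L.Formula (Fin n)) (i : Fin n → J), StrictMono i →
      {y | φ.Realize y} ∈ P n → φ.Realize (a ∘ i) := fun φ i hi hφ =>
    Formula.realize_relabel.1 (ha ⟨⟨_, φ, i⟩, hi, hφ⟩)
  have hiff : ∀ {n : ℕ} (φ : L.Formula (Fin n)) (i : Fin n → J), StrictMono i →
      (φ.Realize (a ∘ i) ↔ {y | φ.Realize y} ∈ P n) := by
    intro n φ i hi
    refine ⟨fun h => ?_, key φ i hi⟩
    by_contra hcon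
    rw [← Ultrafilter.compl_mem_iff_notMem] at hcon
    exact key φ.not i hi hcon h
  refine ⟨K, a, ?_, fun n φ i j hi hj => (hiff φ i hi).trans (hiff φ j hj).symm⟩
  suffices hlt : ∀ i j, i < j → a i ≠ a j by
    intro i j h
    by_contra hne
    rcases lt_or_gt_of_ne hne with hij | hij
    exacts [hlt _ _ hij h, hlt _ _ hij h.symm]
  intro i j hij
  -- The hyperfilter contains no singleton, so almost all pairs have distinct entries.
  have hmem : {y : Fin 2 → N |
      (Formula.not (Term.equal (L := L) (Term.var 0) (Term.var 1))).Realize y} ∈ P 2 := by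
    refine (mem_ultrafilterPower_succ _).2 (Filter.Eventually.of_forall fun x => ?_)
    refine (mem_ultrafilterPower_succ _).2 ?_
    have : {x}ᶜ ∈ Filter.hyperfilter N := (Set.finite_singleton x).compl_mem_hyperfilter
    filter_upwards [this] with y hy
    refine Filter.mem_of_superset Filter.univ_mem fun z _ => ?_
    simpa [Formula.realize_equal] using Ne.symm hy
  have := key _ ![i, j] (by
    intro l l' h
    fin_cases l <;> fin_cases l' <;> simp_all) hmem
  simpa [Formula.realize_equal] using this

/-! ### The Skolem hull as the required model -/

/-- A substructure closed under Skolem functions is elementary. -/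
theorem isElementary_of_skolem {L : FirstOrder.Language.{u, v}} {K : Type w} [L.Structure K]
    (hK : ∀ (n : ℕ) (φ : L.Formula (Fin (n + 1))), ∃ t : L.Term (Fin n), ∀ (x : Fin n → K) (y : K),
      φ.Realize (Fin.snoc x y : Fin (n + 1) → K) →
        φ.Realize (Fin.snoc x (t.realize x) : Fin (n + 1) → K)) (S : L.Substructure K) :
    S.IsElementary := by
  -- In the Tarski–Vaught test the witness is a Skolem term at elements of `S`, and so lies in `S`.
  refine S.isElementary_of_exists fun n φ x y h => ?_
  let ψ : L.Formula (Fin (n + 1)) := φ.toFormula.relabel (Sum.elim Empty.elim id)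
  have hψ : ∀ z : Fin (n + 1) → K, ψ.Realize z ↔ φ.Realize default z := by
    intro z
    rw [Formula.realize_relabel, BoundedFormula.realize_toFormula, iff_iff_eq]
    congr 1
    exact Subsingleton.elim _ _
  obtain ⟨t, ht⟩ := hK n ψ
  refine ⟨⟨t.realize ((↑) ∘ x), ?_⟩, (hψ _).1 (ht _ y ((hψ _).2 h))⟩
  exact t.realize_mem _ fun i => (x i).2

end NIPFewTypes

open NIPFewTypes FirstOrder.Language Cardinal in
theorem mainTheorem11 {L : FirstOrder.Language.{u, v}} (T : L.Theory)
    (hcomplete : T.IsComplete)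
    (hinf : ∃ N : FirstOrder.Language.Theory.ModelType.{u, v, max u v} T, Infinite N)
    (hNIP : NIPFewTypes.TheoryNIP T)
    (κ : Cardinal.{max u v w})
    (hκ : Cardinal.lift.{w, max u v} (NIPFewTypes.theoryCard T) ≤ κ) :
    ∃ M : FirstOrder.Language.Theory.ModelType.{u, v, max u v w} T,
      Cardinal.mk M = κ ∧
      (∀ A : Set M, 2 ≤ Cardinal.mk A →
        Cardinal.mk (NIPFewTypes.AllTypesOver L A) ≤
          Cardinal.mk A ^ Cardinal.lift.{w, max u v} (NIPFewTypes.theoryCard T)) ∧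
      NIPFewTypes.IsSkolemHullOfIndiscernible T M κ := by
  obtain ⟨N, hN⟩ := hinf
  let ι := skolemInclusion L
  let T' := skolemTheory T
  have hsk : IsSkolemization.{u, v, max u v w} ι T T' := isSkolemization_skolemTheory T
  let _ : (skolemLanguage L).Structure N := skolemStructure (skolemInterp L N)
  have hNT : (N : Type _) ⊨ T' := model_skolemTheory T
  -- The index order is an ordinal because the piercing argument needs a well-order.
  obtain ⟨K, a, hainj, haind⟩ :=
    exists_indiscernible.{max u v, v, max u v, max u v w} (L := skolemLanguage L) N κ.ord.ToType
  have hKT : (K : Type _) ⊨ T' := K.is_model.mono Theory.completeTheory.subset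
  let S := Substructure.closure (skolemLanguage L) (Set.range a)
  have hS : S.IsElementary := by
    refine isElementary_of_skolem (fun n φ => ?_) S
    obtain ⟨t, ht⟩ := hsk.skolem n φ
    exact ⟨t, ht (Theory.ModelType.of T' K)⟩
  let E : (skolemLanguage L).ElementarySubstructure K := ⟨S, hS⟩
  have hST : S ⊨ T' := (E.theory_model_iff T').2 hKT
  have hSne : Nonempty S := E.instNonempty
  have haS : ∀ i, a i ∈ S := fun i => Substructure.subset_closure ⟨i, rfl⟩
  let b : κ.ord.ToType → S := fun i => ⟨a i, haS i⟩
  have hbinj : Function.Injective b := fun i j h => hainj (congrArg Subtype.val h)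
  have hbind : Indiscernible (skolemLanguage L) b := by
    intro n φ i j hi hj
    have h : ∀ i : Fin n → κ.ord.ToType, φ.Realize (b ∘ i) ↔ φ.Realize (a ∘ i) := fun i =>
      (E.subtype.map_formula φ (b ∘ i)).symm
    rw [h, h]
    exact haind n φ i j hi hj
  have hgen : Substructure.closure (skolemLanguage L) (Set.range b) = ⊤ := by
    rw [eq_top_iff]
    rintro ⟨y, hy⟩ -
    have hmap :
        (Substructure.closure (skolemLanguage L) (Set.range b)).map S.subtype.toHom = S := by
      rw [Substructure.map_closure, ← Set.range_comp]
      rfl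
    rw [← hmap] at hy
    obtain ⟨z, hz, rfl⟩ := Substructure.mem_map.1 hy
    exact hz
  let _ : L.Structure S := ι.reduct S
  have hexp : ι.IsExpansionOn S := LHom.isExpansionOn_reduct _ _
  have hSTL : S ⊨ T := (LHom.onTheory_model ι T).1 (hST.mono Set.subset_union_left)
  have hc : ℵ₀ ≤ theoryCard T := le_max_left _ _
  have hcard : #S = κ := by
    apply le_antisymm
    · have h := Substructure.lift_card_closure_le (L := skolemLanguage L) (s := Set.range a)
      rw [lift_id'.{max u v, w}, lift_id'.{max u v, w}, lift_umax.{max u v, w}] at h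
      have hfun : #(Σ n, (skolemLanguage L).Functions n) ≤ theoryCard T := by
        have hle := hsk.card_le
        rw [card_eq_card_functions_add_card_relations] at hle
        rw [mk_sigma]
        refine le_trans ?_ ((self_le_add_right _ _).trans hle)
        exact sum_le_sum _ _ fun n => (lift_id'.{v, max u v} _).ge
      have hκ0 : ℵ₀ ≤ κ := (aleph0_le_lift.2 hc).trans hκ
      refine h.trans (max_le hκ0 (add_le_of_le hκ0 ?_ ((lift_le.2 hfun).trans hκ)))
      exact mk_range_le.trans (mk_ord_toType κ).le
    · have := mk_le_of_injective hbinj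
      rwa [mk_ord_toType] at this
  refine ⟨Theory.ModelType.of T S, hcard, fun A hA => ?_, skolemLanguage L, ι, T', hsk, ?_⟩
  · exact card_allTypesOver_le.{u, v, w} ι hNIP hc (le_max_right _ _) hsk.card_le hbind hgen A hA
  · exact ⟨S.inducedStructure, hexp, hST, b, hbinj, hbind, hgen⟩
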